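/- Fix an algebraic language $L$ (operation symbols of finite arity, of arbitrary cardinality). All algebras are nonempty $L$-algebras. A quasi-identity is a sentence $q=(\forall \bar x)[\varphi(\bar x)\to\psi(\bar x)]$, where $\varphi$ is a finite (possibly empty) conjunction of equations between $L$-terms and $\psi$ is an equation; put $q^*=(\forall\bar x)[\neg\varphi(\bar x)]$. A quasivariety is a class of algebras defined by a set of quasi-identities; for an algebra $\mathbf B$, ${\sf Q}(\mathbf B)$ is the quasivariety generated by $\mathbf B$, i.e. the class of all algebras satisfying every quasi-identity true in $\mathbf B$. Let $\mathcal Q$ be a quasivariety, and let $\mathbf F$ be the free algebra for $\mathcal Q$ over the countably infinite set of variables $\{v_0,v_1,\dots\}$, i.e. the algebra of terms over these variables divided by the congruence that identifies $s$ and $t$ when $\mathcal Q\models s\approx t$. A quasi-identity $q$ is $\mathcal Q$-active if $q$ is true in $\mathbf F$ and $q^*$ is not true in $\mathbf F$. The quasivariety $\mathcal Q$ is almost structurally complete (ASC) if every $\mathcal Q$-active quasi-identity holds in $\mathcal Q$. A congruence $\alpha$ of an algebra $\mathbf A$ is a $\mathcal Q$-congruence if $\mathbf A/\alpha\in\mathcal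 Q$. A nontrivial (more than one-element) algebra $\mathbf S\in\mathcal Q$ is $\mathcal Q$-subdirectly irreducible if the equality relation on $S$ is completely meet irreducible among the $\mathcal Q$-congruences of $\mathbf S$, i.e. every set of $\mathcal Q$-congruences of $\mathbf S$ whose intersection is the equality relation contains the equality relation. **Corollary.** Let $\mathbf C$ be any (nonempty) subalgebra of $\mathbf F$, for example the subalgebra $\mathbf F(1)$ generated by $v_0$, or, if $L$ has constants, the subalgebra $\mathbf F(0)$ generated by the empty set. Then: 1. $\mathcal Q$ is ASC if and only if $\mathbf A\times\mathbf C\in{\sf Q}(\mathbf F)$ for every $\mathbf A\in\mathcal Q$; 2. $\mathcal Q$ is ASC if and only if $\mathbf S\times\mathbf C\in{\sf Q}(\mathbf F)$ for every $\mathcal Q$-subdirectly irreducible algebra $\mathbf S$. -/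

import Mathlib

universe u v w w₁ w₂

namespace UnivAlg

open FirstOrder.Language

/-- An algebra in the algebraic language `L`: a nonempty carrier with an interpretation of every
operation symbol. (In the theorem `L` has no relation symbols.) -/
structure Alg (L : FirstOrder.Language.{u, v}) where
  carrier : Type w
  [str : L.Structure carrier]
  [nonempty : Nonempty carrier]

instance (L : FirstOrder.Language.{u, v}) (A : Alg.{u, v, w} L) : L.Structure A.carrier := A.str

instance (L : FirstOrder.Language.{u, v}) (A : Alg.{u, v, w} L) : Nonempty A.carrier := A.nonempty

variable {L : FirstOrder.Language.{u, v}}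

/-! Equations and quasi-identities -/

/-- An equation `s ≈ t` between terms in the variables `v₀, v₁, v₂, …`. -/
abbrev Equation (L : FirstOrder.Language.{u, v}) := L.Term ℕ × L.Term ℕ

/-- The equation `e` holds in `A` under the assignment `x` of elements to the variables. -/
def Equation.HoldsAt (e : Equation L) (A : Alg.{u, v, w} L) (x : ℕ → A.carrier) : Prop :=
  e.1.realize x = e.2.realize x

/-- A quasi-identity `∀ x̄, s₁ ≈ t₁ ∧ ⋯ ∧ sₙ ≈ tₙ → s ≈ t`, where `n = 0` is allowed. -/
structure QuasiIdentity (L : FirstOrder.Language.{u, v}) where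
  premise : List (Equation L)
  conclusion : Equation L

namespace QuasiIdentity

/-- All equations in the premise of `q` hold in `A` under the assignment `x`. -/
def PremiseHoldsAt (q : QuasiIdentity L) (A : Alg.{u, v, w} L) (x : ℕ → A.carrier) : Prop :=
  ∀ e ∈ q.premise, Equation.HoldsAt e A x

/-- `A ⊨ q`. -/
def TrueIn (q : QuasiIdentity L) (A : Alg.{u, v, w} L) : Prop :=
  ∀ x : ℕ → A.carrier, q.PremiseHoldsAt A x → q.conclusion.HoldsAt A x

/-- `A ⊨ q*`, where `q* = ∀ x̄, ¬ φ(x̄)` and `φ` is the premise of `q`. -/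
def StarTrueIn (q : QuasiIdentity L) (A : Alg.{u, v, w} L) : Prop :=
  ∀ x : ℕ → A.carrier, ¬ q.PremiseHoldsAt A x

end QuasiIdentity

/-! Quasivarieties -/

/-- A quasivariety is a class of algebras defined by a set of quasi-identities. -/
def IsQuasivariety (𝒬 : Set (Alg.{u, v, w} L)) : Prop :=
  ∃ T : Set (QuasiIdentity L), 𝒬 = {A | ∀ q ∈ T, q.TrueIn A}

/-- `Q(B)`, the quasivariety generated by the algebra `B`: the class of all algebras that satisfy
every quasi-identity true in `B`. -/
def generatedQuasivariety (B : Alg.{u, v, w₁} L) : Set (Alg.{u, v, w₂} L) :=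
  {A | ∀ q : QuasiIdentity L, q.TrueIn B → q.TrueIn A}

/-! Products and subalgebras -/

/-- The direct product `A × B`, with coordinatewise operations. -/
def Alg.prod (A : Alg.{u, v, w₁} L) (B : Alg.{u, v, w₂} L) : Alg.{u, v, max w₁ w₂} L where
  carrier := A.carrier × B.carrier
  str :=
    { funMap := fun f x =>
        (Structure.funMap f fun i => (x i).1, Structure.funMap f fun i => (x i).2)
      RelMap := fun r x =>
        (Structure.RelMap r fun i => (x i).1) ∧ Structure.RelMap r fun i => (x i).2 }

/-- A nonempty subuniverse of `A`, viewed as an algebra with the restricted operations. -/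
def Alg.ofSubstructure (A : Alg.{u, v, w} L) (C : L.Substructure A.carrier)
    (hC : (C : Set A.carrier).Nonempty) : Alg.{u, v, w} L :=
  haveI : Nonempty C := hC.to_subtype
  { carrier := C }

/-! Congruences, quotients, relatively subdirectly irreducible algebras -/

/-- A congruence of `A`: an equivalence relation compatible with all basic operations. -/
structure Congruence (A : Alg.{u, v, w} L) extends Setoid A.carrier where
  compatible : ∀ {n : ℕ} (f : L.Functions n) (x y : Fin n → A.carrier),
    (∀ i, r (x i) (y i)) → r (Structure.funMap f x) (Structure.funMap f y)

/-- The quotient algebra `A / θ`. -/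
def Alg.quotient [L.IsAlgebraic] (A : Alg.{u, v, w} L) (θ : Congruence A) : Alg.{u, v, w} L :=
  letI : L.Prestructure θ.toSetoid :=
    { toStructure := A.str
      fun_equiv := fun {_ f} x y h => θ.compatible f x y h
      rel_equiv := fun {_ r} _ _ _ => isEmptyElim r }
  { carrier := Quotient θ.toSetoid
    str := quotientStructure
    nonempty := A.nonempty.map (Quotient.mk θ.toSetoid) }

/-- `θ` is a `𝒬`-congruence of `A`, that is, `A / θ ∈ 𝒬`. -/
def IsRelCongruence [L.IsAlgebraic] (𝒬 : Set (Alg.{u, v, w} L)) {A : Alg.{u, v, w} L}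
    (θ : Congruence A) : Prop :=
  A.quotient θ ∈ 𝒬

/-- `S` is `𝒬`-subdirectly irreducible: `S ∈ 𝒬` is nontrivial and the equality relation is
completely meet irreducible among the `𝒬`-congruences of `S`, that is, whenever the meet
(intersection) of a set `X` of `𝒬`-congruences is the equality relation, then the equality relation
belongs to `X`. -/
def IsRelSubdirectlyIrreducible [L.IsAlgebraic] (𝒬 : Set (Alg.{u, v, w} L))
    (S : Alg.{u, v, w} L) : Prop :=
  S ∈ 𝒬 ∧ Nontrivial S.carrier ∧
    ∀ X : Set (Congruence S), (∀ θ ∈ X, IsRelCongruence 𝒬 θ) →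
      (∀ a b : S.carrier, (∀ θ ∈ X, θ.r a b) ↔ a = b) →
        ∃ θ ∈ X, ∀ a b : S.carrier, θ.r a b ↔ a = b

/-! The free algebra of countably infinite rank -/

/-- The algebra of terms over `v₀, v₁, v₂, …`. -/
def termAlg (L : FirstOrder.Language.{u, v}) [L.IsAlgebraic] : Alg.{u, v, u} L where
  carrier := L.Term ℕ
  str :=
    { funMap := fun f ts => Term.func f ts
      RelMap := fun r _ => isEmptyElim r }
  nonempty := ⟨Term.var 0⟩

/-- The congruence of the term algebra that identifies `s` and `t` when the identity `s ≈ t` is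
true in every algebra from `𝒬`. -/
def freeCongruence [L.IsAlgebraic] (𝒬 : Set (Alg.{u, v, w} L)) : Congruence (termAlg L) where
  r := fun (s t : L.Term ℕ) => ∀ A ∈ 𝒬, ∀ x : ℕ → A.carrier, Equation.HoldsAt (s, t) A x
  iseqv :=
    { refl := fun _ _ _ _ => rfl
      symm := fun h A hA x => (h A hA x).symm
      trans := fun h₁ h₂ A hA x => (h₁ A hA x).trans (h₂ A hA x) }
  compatible := fun f _ _ h A hA x =>
    congrArg (Structure.funMap f) (funext fun i => h i A hA x)

/-- `F`, the free algebra for `𝒬` over the countably infinite set of variables: the quotient of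
the term algebra by the congruence of identities true in `𝒬`. -/
def freeAlg [L.IsAlgebraic] (𝒬 : Set (Alg.{u, v, w} L)) : Alg.{u, v, u} L :=
  (termAlg L).quotient (freeCongruence 𝒬)

/-! Almost structural completeness -/

/-- `q` is `𝒬`-active: `q` is true in `F` and `q*` is not. -/
def IsActive [L.IsAlgebraic] (𝒬 : Set (Alg.{u, v, w} L)) (q : QuasiIdentity L) : Prop :=
  q.TrueIn (freeAlg 𝒬) ∧ ¬ q.StarTrueIn (freeAlg 𝒬)

/-- `𝒬` is almost structurally complete: every `𝒬`-active quasi-identity holds in `𝒬`. -/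
def IsASC [L.IsAlgebraic] (𝒬 : Set (Alg.{u, v, w} L)) : Prop :=
  ∀ q : QuasiIdentity L, IsActive 𝒬 q → ∀ A ∈ 𝒬, q.TrueIn A

end UnivAlg

namespace UnivAlg

open FirstOrder.Language

variable {L : FirstOrder.Language.{u, v}}

/-! Evaluation of terms in products, subalgebras and quotients -/

/-! An assignment into `A × C` solves a system of equations iff both coordinates do. If 𝒬 is ASC and
`q` is true in F, a solution of the premise in `A × C` gives one in C ≤ F, so `q` is active and
holds in `A`; it holds in C as a subalgebra of F. Conversely, if `q` is active, its premise is
solvable in F and therefore in C (`exists_premiseHoldsAt_ofSubstructure`). Pairing that solution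
with any solution in `A` and applying `q` in `A × C` gives the conclusion in `A`. For the second
equivalence, a quasi-identity failing in 𝒬 already fails in a 𝒬-subdirectly irreducible quotient. It
is obtained by Zorn's lemma: 𝒬-congruences are closed under unions of chains because operations and
premises are finitary. -/

theorem realize_prod (A : Alg.{u, v, w₁} L) (B : Alg.{u, v, w₂} L)
    (x : ℕ → (A.prod B).carrier) (t : L.Term ℕ) :
    t.realize x = (t.realize (fun i => (x i).1), t.realize (fun i => (x i).2)) := by
  induction t with
  | var i => rfl
  | func f ts ih =>
    simp only [Term.realize_func, ih]
    rfl

theorem realize_ofSubstructure (A : Alg.{u, v, w} L) (C : L.Substructure A.carrier)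
    (hC : (C : Set A.carrier).Nonempty) (x : ℕ → (A.ofSubstructure C hC).carrier)
    (t : L.Term ℕ) :
    (t.realize x).1 = t.realize (fun i => (x i).1) := by
  induction t with
  | var i => rfl
  | func f ts ih =>
    simp only [Term.realize_func, ← ih]
    rfl

theorem holdsAt_prod_iff (e : Equation L) (A : Alg.{u, v, w₁} L) (B : Alg.{u, v, w₂} L)
    (x : ℕ → (A.prod B).carrier) :
    e.HoldsAt (A.prod B) x ↔
      e.HoldsAt A (fun i => (x i).1) ∧ e.HoldsAt B (fun i => (x i).2) := by
  unfold Equation.HoldsAt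
  rw [realize_prod, realize_prod]
  exact Prod.ext_iff

theorem holdsAt_ofSubstructure_iff (e : Equation L) (A : Alg.{u, v, w} L)
    (C : L.Substructure A.carrier) (hC : (C : Set A.carrier).Nonempty)
    (x : ℕ → (A.ofSubstructure C hC).carrier) :
    e.HoldsAt (A.ofSubstructure C hC) x ↔ e.HoldsAt A (fun i => (x i).1) := by
  unfold Equation.HoldsAt
  rw [← realize_ofSubstructure, ← realize_ofSubstructure]
  exact Subtype.ext_iff

theorem QuasiIdentity.TrueIn.ofSubstructure {q : QuasiIdentity L} {A : Alg.{u, v, w} L}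
    (hq : q.TrueIn A) (C : L.Substructure A.carrier) (hC : (C : Set A.carrier).Nonempty) :
    q.TrueIn (A.ofSubstructure C hC) := fun x hx =>
  (holdsAt_ofSubstructure_iff _ A C hC x).2
    (hq _ fun e he => (holdsAt_ofSubstructure_iff e A C hC x).1 (hx e he))

variable [L.IsAlgebraic]

/-- The canonical projection of an algebra onto its quotient by a congruence. -/
def Congruence.proj {A : Alg.{u, v, w} L} (θ : Congruence A) (a : A.carrier) :
    (A.quotient θ).carrier :=
  Quotient.mk θ.toSetoid a

theorem Congruence.proj_surjective {A : Alg.{u, v, w} L} (θ : Congruence A) :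
    Function.Surjective θ.proj :=
  Quotient.mk_surjective

theorem Congruence.proj_eq_iff {A : Alg.{u, v, w} L} (θ : Congruence A) {a b : A.carrier} :
    θ.proj a = θ.proj b ↔ θ.r a b :=
  Quotient.eq

theorem funMap_quotient {A : Alg.{u, v, w} L} (θ : Congruence A) {n : ℕ} (f : L.Functions n)
    (x : Fin n → A.carrier) :
    Structure.funMap f (fun i => θ.proj (x i)) = θ.proj (Structure.funMap f x) := by
  -- The same prestructure as in `Alg.quotient`, so that the Mathlib lemma applies definitionally.
  let : L.Prestructure θ.toSetoid :=
    { toStructure := A.str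
      fun_equiv := fun {_ f} x y h => θ.compatible f x y h
      rel_equiv := fun {_ r} _ _ _ => isEmptyElim r }
  exact FirstOrder.Language.funMap_quotient_mk' θ.toSetoid f x

theorem realize_quotient {A : Alg.{u, v, w} L} (θ : Congruence A) (x : ℕ → A.carrier)
    (t : L.Term ℕ) :
    t.realize (fun i => θ.proj (x i)) = θ.proj (t.realize x) := by
  induction t with
  | var i => rfl
  | func f ts ih => simp only [Term.realize_func, ih, funMap_quotient]

theorem holdsAt_quotient_iff (e : Equation L) {A : Alg.{u, v, w} L} (θ : Congruence A)
    (x : ℕ → A.carrier) :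
    e.HoldsAt (A.quotient θ) (fun i => θ.proj (x i)) ↔ θ.r (e.1.realize x) (e.2.realize x) := by
  unfold Equation.HoldsAt
  rw [realize_quotient, realize_quotient, θ.proj_eq_iff]

/-- Assignments lift along the surjective projection. Being a 𝒬-congruence thus becomes a closure
condition on `θ` alone, the form used for all congruences below. -/
theorem trueIn_quotient_iff (q : QuasiIdentity L) {A : Alg.{u, v, w} L} (θ : Congruence A) :
    q.TrueIn (A.quotient θ) ↔ ∀ x : ℕ → A.carrier,
      (∀ e ∈ q.premise, θ.r (e.1.realize x) (e.2.realize x)) →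
        θ.r (q.conclusion.1.realize x) (q.conclusion.2.realize x) := by
  constructor
  · intro h x hx
    exact (holdsAt_quotient_iff _ θ x).1
      (h _ fun e he => (holdsAt_quotient_iff e θ x).2 (hx e he))
  · intro h y hy
    obtain ⟨x, rfl⟩ := θ.proj_surjective.comp_left y
    exact (holdsAt_quotient_iff _ θ x).2
      (h x fun e he => (holdsAt_quotient_iff e θ x).1 (hy e he))

/-! The free algebra -/

theorem realize_termAlg (σ : ℕ → L.Term ℕ) (t : L.Term ℕ) :
    (t.realize (M := (termAlg L).carrier) σ : L.Term ℕ) = t.subst σ := by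
  induction t with
  | var i => rfl
  | func f ts ih =>
    exact congrArg (Term.func f) (funext ih)

/-- The element of the free algebra represented by a term. -/
def freeAlg.mk (𝒬 : Set (Alg.{u, v, w} L)) (t : L.Term ℕ) : (freeAlg 𝒬).carrier :=
  (freeCongruence 𝒬).proj t

theorem freeAlg.mk_surjective (𝒬 : Set (Alg.{u, v, w} L)) :
    Function.Surjective (freeAlg.mk 𝒬) :=
  (freeCongruence 𝒬).proj_surjective

theorem realize_freeAlg (𝒬 : Set (Alg.{u, v, w} L)) (σ : ℕ → L.Term ℕ) (t : L.Term ℕ) :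
    t.realize (fun i => freeAlg.mk 𝒬 (σ i)) = freeAlg.mk 𝒬 (t.subst σ) :=
  (realize_quotient (freeCongruence 𝒬) σ t).trans (congrArg (freeAlg.mk 𝒬) (realize_termAlg σ t))

/-- An equation solvable in the free algebra holds, after substituting the solution, throughout
the quasivariety, and conversely. -/
theorem freeAlg_holdsAt_subst_iff (𝒬 : Set (Alg.{u, v, w} L)) (e : Equation L)
    (σ : ℕ → L.Term ℕ) :
    e.HoldsAt (freeAlg 𝒬) (fun i => freeAlg.mk 𝒬 (σ i)) ↔
      ∀ A ∈ 𝒬, ∀ x : ℕ → A.carrier, e.HoldsAt A (fun i => (σ i).realize x) := by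
  unfold Equation.HoldsAt
  rw [realize_freeAlg, realize_freeAlg]
  refine (freeCongruence 𝒬).proj_eq_iff.trans (forall₃_congr fun A _ x => ?_)
  change (e.1.subst σ).realize x = (e.2.subst σ).realize x ↔ _
  rw [Term.realize_subst, Term.realize_subst]

/-- A system of equations solvable in the free algebra is solvable in each of its subalgebras. -/
theorem exists_premiseHoldsAt_ofSubstructure (𝒬 : Set (Alg.{u, v, w} L)) (q : QuasiIdentity L)
    (hq : ¬ q.StarTrueIn (freeAlg 𝒬)) (C : L.Substructure (freeAlg 𝒬).carrier)
    (hC : (C : Set (freeAlg 𝒬).carrier).Nonempty) :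
    ∃ z, q.PremiseHoldsAt ((freeAlg 𝒬).ofSubstructure C hC) z := by
  obtain ⟨y, hy⟩ : ∃ y, q.PremiseHoldsAt (freeAlg 𝒬) y := by
    simpa [QuasiIdentity.StarTrueIn] using hq
  obtain ⟨σ, rfl⟩ := (freeAlg.mk_surjective 𝒬).comp_left y
  obtain ⟨c, hc⟩ := id hC
  obtain ⟨s, rfl⟩ := freeAlg.mk_surjective 𝒬 c
  -- Send every variable to one element of `C`, the class of `s`; the terms `σ i` evaluated there
  -- stay in `C`.
  let z : ℕ → ((freeAlg 𝒬).ofSubstructure C hC).carrier := fun _ => ⟨_, hc⟩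
  refine ⟨fun i => (σ i).realize z, fun e he => ?_⟩
  rw [holdsAt_ofSubstructure_iff]
  have hz : (fun i => ((σ i).realize z).1) =
      fun i => freeAlg.mk 𝒬 ((σ i).subst fun _ => s) := funext fun i => by
    rw [realize_ofSubstructure]
    exact realize_freeAlg 𝒬 (fun _ => s) (σ i)
  rw [hz, freeAlg_holdsAt_subst_iff]
  -- The premise under `σ` is a set of identities of 𝒬, so it survives substituting `s` for all
  -- variables.
  intro A hA x
  simp only [Term.realize_subst]
  exact (freeAlg_holdsAt_subst_iff 𝒬 e σ).1 (hy e he) A hA _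

/-! Relatively subdirectly irreducible quotients -/

/-- The union of a nonempty chain of congruences. -/
def Congruence.sUnion {A : Alg.{u, v, w} L} (X : Set (Congruence A)) (hne : X.Nonempty)
    (hX : ∀ θ ∈ X, ∀ ψ ∈ X, (∀ a b, θ.r a b → ψ.r a b) ∨ ∀ a b, ψ.r a b → θ.r a b) :
    Congruence A where
  r a b := ∃ θ ∈ X, θ.r a b
  iseqv :=
    { refl := fun a => hne.imp fun θ h => ⟨h, θ.iseqv.refl a⟩
      symm := fun ⟨θ, h, hab⟩ => ⟨θ, h, θ.iseqv.symm hab⟩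
      trans := by
        rintro a b c ⟨θ, hθ, hab⟩ ⟨ψ, hψ, hbc⟩
        rcases hX θ hθ ψ hψ with h | h
        · exact ⟨ψ, hψ, ψ.iseqv.trans (h _ _ hab) hbc⟩
        · exact ⟨θ, hθ, θ.iseqv.trans hab (h _ _ hbc)⟩ }
  compatible := by
    intro n f x y h
    -- Arities are finite, so a single member of the chain relates all arguments.
    have key : ∀ s : Finset (Fin n), ∃ θ ∈ X, ∀ i ∈ s, θ.r (x i) (y i) := by
      intro s
      induction s using Finset.induction_on with
      | empty => exact hne.imp fun θ h => ⟨h, by simp⟩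
      | insert i s _ ih =>
        obtain ⟨θ, hθ, hs⟩ := ih
        obtain ⟨ψ, hψ, hi⟩ := h i
        rcases hX θ hθ ψ hψ with hle | hle
        · exact ⟨ψ, hψ, Finset.forall_mem_insert _ _ _ |>.2 ⟨hi, fun j hj => hle _ _ (hs j hj)⟩⟩
        · exact ⟨θ, hθ, Finset.forall_mem_insert _ _ _ |>.2 ⟨hle _ _ hi, hs⟩⟩
    obtain ⟨θ, hθ, hs⟩ := key Finset.univ
    exact ⟨θ, hθ, θ.compatible f x y fun i => hs i (Finset.mem_univ i)⟩

/-- Relative congruences are closed under unions of chains. -/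
theorem isRelCongruence_sUnion {𝒬 : Set (Alg.{u, v, w} L)} (h𝒬 : IsQuasivariety 𝒬)
    {A : Alg.{u, v, w} L} (X : Set (Congruence A)) (hne : X.Nonempty)
    (hX : ∀ θ ∈ X, ∀ ψ ∈ X, (∀ a b, θ.r a b → ψ.r a b) ∨ ∀ a b, ψ.r a b → θ.r a b)
    (hrel : ∀ θ ∈ X, IsRelCongruence 𝒬 θ) :
    IsRelCongruence 𝒬 (Congruence.sUnion X hne hX) := by
  obtain ⟨T, rfl⟩ := h𝒬
  intro q hq
  rw [trueIn_quotient_iff]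
  intro x hx
  -- Likewise, a finite premise is already satisfied modulo one member of the chain.
  have key : ∀ l : List (Equation L),
      (∀ e ∈ l, (Congruence.sUnion X hne hX).r (e.1.realize x) (e.2.realize x)) →
      ∃ θ ∈ X, ∀ e ∈ l, θ.r (e.1.realize x) (e.2.realize x) := by
    intro l
    induction l with
    | nil => exact fun _ => hne.imp fun θ h => ⟨h, by simp⟩
    | cons e l ih =>
      intro hl
      rw [List.forall_mem_cons] at hl
      obtain ⟨θ, hθ, hs⟩ := ih hl.2
      obtain ⟨ψ, hψ, hi⟩ := hl.1
      rcases hX θ hθ ψ hψ with hle | hle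
      · exact ⟨ψ, hψ, List.forall_mem_cons.2 ⟨hi, fun j hj => hle _ _ (hs j hj)⟩⟩
      · exact ⟨θ, hθ, List.forall_mem_cons.2 ⟨hle _ _ hi, hs⟩⟩
  obtain ⟨θ, hθ, hs⟩ := key q.premise hx
  exact ⟨θ, hθ, (trueIn_quotient_iff q θ).1 (hrel θ hθ q hq) x hs⟩

/-- The preimage of a congruence of a quotient algebra under the canonical projection. -/
def Congruence.comap {A : Alg.{u, v, w} L} (θ : Congruence A) (ψ : Congruence (A.quotient θ)) :
    Congruence A where
  r a b := ψ.r (θ.proj a) (θ.proj b)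
  iseqv :=
    { refl := fun _ => ψ.iseqv.refl _
      symm := fun h => ψ.iseqv.symm h
      trans := fun h₁ h₂ => ψ.iseqv.trans h₁ h₂ }
  compatible := fun f x y h => by
    rw [← funMap_quotient, ← funMap_quotient]
    exact ψ.compatible f _ _ h

/-- In effect the third isomorphism theorem: `A / θ.comap ψ` is `(A / θ) / ψ`. -/
theorem isRelCongruence_comap {𝒬 : Set (Alg.{u, v, w} L)} (h𝒬 : IsQuasivariety 𝒬)
    {A : Alg.{u, v, w} L} (θ : Congruence A) (ψ : Congruence (A.quotient θ))
    (hψ : IsRelCongruence 𝒬 ψ) : IsRelCongruence 𝒬 (θ.comap ψ) := by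
  obtain ⟨T, rfl⟩ := h𝒬
  intro q hq
  rw [trueIn_quotient_iff]
  intro x hx
  have h := (trueIn_quotient_iff q ψ).1 (hψ q hq) (fun i => θ.proj (x i))
  simp only [realize_quotient] at h
  exact h hx

/-- The equality relation, as a congruence. -/
def Congruence.eq (A : Alg.{u, v, w} L) : Congruence A where
  r a b := a = b
  iseqv := eq_equivalence
  compatible := fun _ _ _ h => congrArg _ (funext h)

theorem isRelCongruence_eq {𝒬 : Set (Alg.{u, v, w} L)} (h𝒬 : IsQuasivariety 𝒬)
    {A : Alg.{u, v, w} L} (hA : A ∈ 𝒬) : IsRelCongruence 𝒬 (Congruence.eq A) := by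
  obtain ⟨T, rfl⟩ := h𝒬
  exact fun q hq => (trueIn_quotient_iff q _).2 (hA q hq)

/-- Two distinct elements of an algebra in a quasivariety are not identified by some relative
congruence that is maximal with this property. -/
theorem exists_maximal_isRelCongruence {𝒬 : Set (Alg.{u, v, w} L)} (h𝒬 : IsQuasivariety 𝒬)
    {A : Alg.{u, v, w} L} (hA : A ∈ 𝒬) {a b : A.carrier} (hab : a ≠ b) :
    ∃ θ : Congruence A, IsRelCongruence 𝒬 θ ∧ ¬ θ.r a b ∧
      ∀ ψ : Congruence A, IsRelCongruence 𝒬 ψ → ¬ ψ.r a b →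
        (∀ c d, θ.r c d → ψ.r c d) → ∀ c d, ψ.r c d → θ.r c d := by
  let P := {θ : Congruence A // IsRelCongruence 𝒬 θ ∧ ¬ θ.r a b}
  have hP : Nonempty P := ⟨⟨Congruence.eq A, isRelCongruence_eq h𝒬 hA, hab⟩⟩
  obtain ⟨θ, hθ⟩ := exists_maximal_of_nonempty_chains_bounded
    (r := fun θ ψ : P => ∀ c d, θ.1.r c d → ψ.1.r c d)
    (fun X hX hne => by
      have hchain : ∀ θ ∈ Subtype.val '' X, ∀ ψ ∈ Subtype.val '' X,
          (∀ c d, θ.r c d → ψ.r c d) ∨ ∀ c d, ψ.r c d → θ.r c d := by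
        rintro _ ⟨θ, hθ, rfl⟩ _ ⟨ψ, hψ, rfl⟩
        -- A chain only compares distinct members.
        by_cases h : θ = ψ
        · exact Or.inl fun _ _ h' => h ▸ h'
        · exact hX hθ hψ h
      refine ⟨⟨Congruence.sUnion _ (hne.image _) hchain,
        isRelCongruence_sUnion h𝒬 _ _ _ (by rintro _ ⟨θ, -, rfl⟩; exact θ.2.1), ?_⟩,
        fun θ hθ c d h => ⟨θ.1, ⟨θ, hθ, rfl⟩, h⟩⟩
      rintro ⟨_, ⟨θ, -, rfl⟩, h⟩
      exact θ.2.2 h)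
    (fun h₁ h₂ c d h => h₂ c d (h₁ c d h))
  exact ⟨θ.1, θ.2.1, θ.2.2, fun ψ h₁ h₂ => hθ ⟨ψ, h₁, h₂⟩⟩

/-- Distinct elements of an algebra in a quasivariety are separated by a relatively subdirectly
irreducible quotient. -/
theorem exists_isRelSubdirectlyIrreducible_quotient {𝒬 : Set (Alg.{u, v, w} L)}
    (h𝒬 : IsQuasivariety 𝒬) {A : Alg.{u, v, w} L} (hA : A ∈ 𝒬) {a b : A.carrier} (hab : a ≠ b) :
    ∃ θ : Congruence A, IsRelSubdirectlyIrreducible 𝒬 (A.quotient θ) ∧ ¬ θ.r a b := by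
  obtain ⟨θ, hθ, hne, hmax⟩ := exists_maximal_isRelCongruence h𝒬 hA hab
  have hne' : θ.proj a ≠ θ.proj b := fun h => hne (θ.proj_eq_iff.1 h)
  refine ⟨θ, ⟨hθ, ⟨_, _, hne'⟩, fun X hX hmeet => ?_⟩, hne⟩
  -- Some member of `X` separates the images of `a` and `b`. Its pullback contains `θ` and still
  -- separates `a` from `b`, so by maximality it is `θ`, and the member is equality.
  obtain ⟨ψ, hψX, hψ⟩ : ∃ ψ ∈ X, ¬ ψ.r (θ.proj a) (θ.proj b) := by
    by_contra! h
    exact hne' ((hmeet _ _).1 h)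
  refine ⟨ψ, hψX, fun c d => ⟨fun h => ?_, fun h => h ▸ ψ.iseqv.refl c⟩⟩
  obtain ⟨c, rfl⟩ := θ.proj_surjective c
  obtain ⟨d, rfl⟩ := θ.proj_surjective d
  refine θ.proj_eq_iff.2 (hmax (θ.comap ψ) (isRelCongruence_comap h𝒬 θ ψ (hX ψ hψX)) hψ ?_ c d h)
  intro c' d' h'
  change ψ.r (θ.proj c') (θ.proj d')
  rw [θ.proj_eq_iff.2 h']

/-! Almost structural completeness -/

theorem IsASC.prod_mem {𝒬 : Set (Alg.{u, v, w} L)} (h : IsASC 𝒬) {A : Alg.{u, v, w} L}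
    (hA : A ∈ 𝒬) (C : L.Substructure (freeAlg 𝒬).carrier)
    (hC : (C : Set (freeAlg 𝒬).carrier).Nonempty) :
    A.prod ((freeAlg 𝒬).ofSubstructure C hC) ∈ generatedQuasivariety (freeAlg 𝒬) := by
  intro q hq x hx
  have hx₁ := fun e he => ((holdsAt_prod_iff e _ _ x).1 (hx e he)).1
  have hx₂ := fun e he => ((holdsAt_prod_iff e _ _ x).1 (hx e he)).2
  refine (holdsAt_prod_iff _ _ _ x).2 ⟨h q ⟨hq, fun hstar => ?_⟩ A hA _ hx₁,
    hq.ofSubstructure C hC _ hx₂⟩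
  -- The second coordinate of `x` solves the premise in F, which refutes `q*`.
  exact hstar _ fun e he => (holdsAt_ofSubstructure_iff e _ C hC _).1 (hx₂ e he)

theorem IsActive.trueIn_of_prod_mem {𝒬 : Set (Alg.{u, v, w} L)} {q : QuasiIdentity L}
    (hq : IsActive 𝒬 q) {A : Alg.{u, v, w₁} L} (C : L.Substructure (freeAlg 𝒬).carrier)
    (hC : (C : Set (freeAlg 𝒬).carrier).Nonempty)
    (hA : A.prod ((freeAlg 𝒬).ofSubstructure C hC) ∈ generatedQuasivariety (freeAlg 𝒬)) :
    q.TrueIn A := by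
  intro x hx
  obtain ⟨z, hz⟩ := exists_premiseHoldsAt_ofSubstructure 𝒬 q hq.2 C hC
  exact ((holdsAt_prod_iff _ _ _ _).1 (hA q hq.1 (fun i => (x i, z i)) fun e he =>
    (holdsAt_prod_iff e A _ _).2 ⟨hx e he, hz e he⟩)).1

/-- A quasi-identity true in all relatively subdirectly irreducible algebras of a quasivariety is
true in the quasivariety. -/
theorem trueIn_of_forall_isRelSubdirectlyIrreducible {𝒬 : Set (Alg.{u, v, w} L)}
    (h𝒬 : IsQuasivariety 𝒬) {q : QuasiIdentity L}
    (hq : ∀ S : Alg.{u, v, w} L, IsRelSubdirectlyIrreducible 𝒬 S → q.TrueIn S)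
    {A : Alg.{u, v, w} L} (hA : A ∈ 𝒬) : q.TrueIn A := by
  intro x hx
  by_contra hne
  -- Separate the two sides of the failing conclusion; the premise passes to every quotient, so `q`
  -- would fail in this one.
  obtain ⟨θ, hθ, hab⟩ := exists_isRelSubdirectlyIrreducible_quotient h𝒬 hA hne
  refine hab ((trueIn_quotient_iff q θ).1 (hq _ hθ) x fun e he => ?_)
  rw [show e.1.realize x = e.2.realize x from hx e he]

end UnivAlg

theorem corollary3p2 (L : FirstOrder.Language.{u, v}) [L.IsAlgebraic]
    (𝒬 : Set (UnivAlg.Alg.{u, v, max u w} L)) (h𝒬 : UnivAlg.IsQuasivariety 𝒬)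
    (C : L.Substructure (UnivAlg.freeAlg 𝒬).carrier)
    (hC : (C : Set (UnivAlg.freeAlg 𝒬).carrier).Nonempty) :
    (UnivAlg.IsASC 𝒬 ↔
      ∀ A : UnivAlg.Alg.{u, v, max u w} L, A ∈ 𝒬 →
        A.prod ((UnivAlg.freeAlg 𝒬).ofSubstructure C hC) ∈
          UnivAlg.generatedQuasivariety (UnivAlg.freeAlg 𝒬)) ∧
    (UnivAlg.IsASC 𝒬 ↔
      ∀ S : UnivAlg.Alg.{u, v, max u w} L, UnivAlg.IsRelSubdirectlyIrreducible 𝒬 S →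
        S.prod ((UnivAlg.freeAlg 𝒬).ofSubstructure C hC) ∈
          UnivAlg.generatedQuasivariety (UnivAlg.freeAlg 𝒬)) := by
  refine ⟨⟨fun h A hA => h.prod_mem hA C hC,
    fun h q hq A hA => hq.trueIn_of_prod_mem C hC (h A hA)⟩,
    fun h S hS => h.prod_mem hS.1 C hC, fun h q hq A hA => ?_⟩
  exact UnivAlg.trueIn_of_forall_isRelSubdirectlyIrreducible h𝒬
    (fun S hS => hq.trueIn_of_prod_mem C hC (h S hS)) hA
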